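/- Let $d\ge 1$ and let $\Omega\subset\mathbb R^d$ be an open set. Let $(\cdot,\cdot)$ be the $L^2(\Omega)$ inner product (of real functions or of vector fields), let $H(\mathrm{div};\Omega)$ be the space of the vector fields in $L^2(\Omega)^d$ whose weak divergence lies in $L^2(\Omega)$, and let $H^1_0(\Omega)$ be the closure of $C_c^\infty(\Omega)$ in $H^1(\Omega)$. The Laplace eigenproblem is: find $\lambda\in\mathbb R$ and $0\ne u\in H^1_0(\Omega)$ such that $(\nabla u,\nabla v)=\lambda(u,v)$ for all $v\in H^1_0(\Omega)$. The $LL^*$ eigenproblem is: find $\mu\in\mathbb R$ and $0\ne p\in H^1_0(\Omega)$ such that for some $\chi\in H(\mathrm{div};\Omega)$ $$(\chi,\xi)+(\operatorname{div}\chi,\operatorname{div}\xi)-(\nabla p,\xi)=0\quad\forall\,\xi\in H(\mathrm{div};\Omega),$$ $$-(\chi,\nabla q)+(\nabla p,\nabla q)=\mu(p,q)\quad\forall\,q\in H^1_0(\Omega).$$ Then every eigenvalue $\mu$ of the $LL^*$ eigenproblem is positive, and the map $$\mu\mapsto\lambda=\frac{\mu+\sqrt{\mu^2+4\mu}}{2}$$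 is a bijection from the set of eigenvalues of the $LL^*$ eigenproblem onto the set of eigenvalues of the Laplace eigenproblem. Moreover, if $(\mu,p,\chi)$ solves the $LL^*$ eigenproblem and $\lambda$ corresponds to $\mu$, then $u=-\operatorname{div}\chi$ is a Laplace eigenfunction with eigenvalue $\lambda$ (in particular it is nonzero and lies in $H^1_0(\Omega)$), and $\nabla u=\nabla p-\chi$. Conversely, if $\mu$ is an eigenvalue of the $LL^*$ eigenproblem and $\lambda$ corresponds to $\mu$, then every Laplace eigenfunction $u$ with eigenvalue $\lambda$ is equal to $-\operatorname{div}\chi$ for a solution $(\mu,p,\chi)$ of the $LL^*$ eigenproblem, and $p$ is uniquely determined by $u$. -/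

import Mathlib

open MeasureTheory
open scoped ContDiff

namespace LLStar

noncomputable section

/-- The Euclidean space of dimension `d`. -/
abbrev E (d : ℕ) : Type := EuclideanSpace ℝ (Fin d)

/-- The Hilbert space of (classes of) real square integrable functions on `Ω`. -/
abbrev L2 {d : ℕ} (Ω : Set (E d)) : Type := Lp ℝ 2 (volume.restrict Ω)

/-- The Hilbert space of (classes of) square integrable vector fields on `Ω`. -/
abbrev L2Vec {d : ℕ} (Ω : Set (E d)) : Type := Lp (E d) 2 (volume.restrict Ω)

/-- `φ` is a test function on `Ω`: smooth, with compact support contained in `Ω`. -/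
def IsTest {d : ℕ} (Ω : Set (E d)) (φ : E d → ℝ) : Prop :=
  ContDiff ℝ ∞ φ ∧ HasCompactSupport φ ∧ tsupport φ ⊆ Ω

/-- `g` is the weak gradient of `u`, so that `u` belongs to `H¹(Ω)` and `∇u = g`. -/
def HasWeakGrad {d : ℕ} (Ω : Set (E d)) (u : L2 Ω) (g : L2Vec Ω) : Prop :=
  ∀ φ : E d → ℝ, IsTest Ω φ →
    ∫ x in Ω, u x • gradient φ x = - ∫ x in Ω, φ x • g x

/-- `w` is the weak divergence of `ξ`, so that `ξ` belongs to `H(div; Ω)` and `div ξ = w`. -/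
def HasWeakDiv {d : ℕ} (Ω : Set (E d)) (ξ : L2Vec Ω) (w : L2 Ω) : Prop :=
  ∀ φ : E d → ℝ, IsTest Ω φ →
    ∫ x in Ω, inner ℝ (ξ x) (gradient φ x) = - ∫ x in Ω, w x * φ x

/-- `u` belongs to `H¹₀(Ω)`, the closure of the test functions in `H¹(Ω)`, and `∇u = g`. -/
def HasGradH10 {d : ℕ} (Ω : Set (E d)) (u : L2 Ω) (g : L2Vec Ω) : Prop :=
  HasWeakGrad Ω u g ∧
    ∀ ε : ENNReal, 0 < ε → ∃ φ : E d → ℝ, IsTest Ω φ ∧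
      eLpNorm (fun x => u x - φ x) 2 (volume.restrict Ω) < ε ∧
      eLpNorm (fun x => g x - gradient φ x) 2 (volume.restrict Ω) < ε

/-- `u` is an eigenfunction of the Dirichlet Laplace problem `-Δu = lam u`, `u ∈ H¹₀(Ω)`,
in variational form. -/
def IsLaplaceEigenfunction {d : ℕ} (Ω : Set (E d)) (lam : ℝ) (u : L2 Ω) : Prop :=
  u ≠ 0 ∧ ∃ g : L2Vec Ω, HasGradH10 Ω u g ∧
    ∀ (v : L2 Ω) (gv : L2Vec Ω), HasGradH10 Ω v gv → inner ℝ g gv = lam * inner ℝ u v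

/-- `lam` is an eigenvalue of the Dirichlet Laplace problem. -/
def IsLaplaceEigenvalue {d : ℕ} (Ω : Set (E d)) (lam : ℝ) : Prop :=
  ∃ u : L2 Ω, IsLaplaceEigenfunction Ω lam u

/-- `(mu, p, χ)` solves the `LL*` eigenproblem, where `p ∈ H¹₀(Ω)`, `p ≠ 0`, `∇p = gp`,
and `χ ∈ H(div; Ω)`, `div χ = dχ`:
`(χ, ξ) + (div χ, div ξ) - (∇p, ξ) = 0` for all `ξ ∈ H(div; Ω)` and
`-(χ, ∇q) + (∇p, ∇q) = mu (p, q)` for all `q ∈ H¹₀(Ω)`. -/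
structure IsLLStarSolution {d : ℕ} (Ω : Set (E d)) (mu : ℝ)
    (p : L2 Ω) (gp : L2Vec Ω) (χ : L2Vec Ω) (dχ : L2 Ω) : Prop where
  p_ne_zero : p ≠ 0
  grad_p : HasGradH10 Ω p gp
  div_chi : HasWeakDiv Ω χ dχ
  first_eq : ∀ (ξ : L2Vec Ω) (dξ : L2 Ω), HasWeakDiv Ω ξ dξ →
    inner ℝ χ ξ + inner ℝ dχ dξ - inner ℝ gp ξ = 0
  second_eq : ∀ (q : L2 Ω) (gq : L2Vec Ω), HasGradH10 Ω q gq →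
    - inner ℝ χ gq + inner ℝ gp gq = mu * inner ℝ p q

/-- `mu` is an eigenvalue of the `LL*` eigenproblem. -/
def IsLLStarEigenvalue {d : ℕ} (Ω : Set (E d)) (mu : ℝ) : Prop :=
  ∃ (p : L2 Ω) (gp χ : L2Vec Ω) (dχ : L2 Ω), IsLLStarSolution Ω mu p gp χ dχ

/-- The Laplace eigenvalue that corresponds to the `LL*` eigenvalue `mu`. -/
def toLaplace (mu : ℝ) : ℝ := (mu + Real.sqrt (mu ^ 2 + 4 * mu)) / 2

end

end LLStar

/-!
The Laplace eigenproblem and the `LL*` eigenproblem are compared by pure Hilbert space duality.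
Let `T` be the graph of the gradient on test functions, a subspace of `L²(Ω) × L²(Ω)ᵈ`
(`testGraph`). By definition `(div ξ, ξ)` runs through `Tᗮ` when `ξ` runs through `H(div; Ω)`
(`hasWeakDiv_iff`), and therefore `(u, ∇u)` runs through the closure `Tᗮᗮ` of `T` when `u` runs
through `H¹₀(Ω)` (`hasGradH10_iff`); the weak gradient is recovered there by pairing with the
smooth fields `φ e`, whose divergence is `∂ₑφ`. So a function lies in `H¹₀(Ω)` as soon as the
integration by parts formula holds against all of `H(div; Ω)`, and conversely.

In this light the first `LL*` equation says that `u = -div χ` is in `H¹₀(Ω)` with `∇u = ∇p - χ`,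
and the system reads `-Δu = μ p`, `-Δp = μ p + u`, weakly. The matrix of this system has the
eigenvalues given by the roots `λ > 0 > λ'` of `x² = μ x + μ`, where `λ` is `toLaplace μ`.
The combination `u + λ' p` satisfies the Laplace equation with the negative eigenvalue `λ'`, so it
vanishes, and `u = -λ' p` is a Laplace eigenfunction for `λ`
(`IsLLStarSolution.neg_div_eq`). Conversely, a Laplace eigenfunction `u` for `λ` gives the solution
`p = (λ / μ) u`, `χ = ∇p - ∇u` for `μ = λ² / (λ + 1)`
(`IsLaplaceEigenfunction.exists_isLLStarSolution`).

Positivity of the eigenvalues on an arbitrary, possibly unbounded, open set needs that a function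
`p` in `H¹₀(Ω)` with `∇p = 0` vanishes (`HasGradH10.eq_zero_of_grad_eq_zero`). For this, the field
`p arctan(x₁) e₁` is in `H(div; Ω)` with divergence `p / (1 + x₁²)`, and pairing it with `(p, 0)`
gives `∫ p² / (1 + x₁²) = 0`.
-/

namespace LLStar

section

variable {d : ℕ} {Ω : Set (E d)}

/-! ### Test functions and the graph of their gradient -/

theorem contDiff_gradient {φ : E d → ℝ} (hφ : ContDiff ℝ ∞ φ) : ContDiff ℝ ∞ (gradient φ) :=
  (InnerProductSpace.toDual ℝ (E d)).symm.toContinuousLinearEquiv.contDiff.comp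
    (hφ.fderiv_right (by simp))

theorem inner_gradient {φ : E d → ℝ} (x e : E d) :
    inner ℝ e (gradient φ x) = fderiv ℝ φ x e := by
  rw [real_inner_comm, inner_gradient_left]

theorem gradient_eq_zero_of_notMem_tsupport {φ : E d → ℝ} {x : E d} (hx : x ∉ tsupport φ) :
    gradient φ x = 0 := by
  refine ext_inner_left ℝ fun e => ?_
  rw [inner_gradient, fderiv_of_notMem_tsupport (𝕜 := ℝ) hx]
  simp

namespace IsTest

variable {φ ψ : E d → ℝ}

theorem hasCompactSupport_gradient (h : IsTest Ω φ) : HasCompactSupport (gradient φ) :=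
  HasCompactSupport.intro h.2.1 fun _ => gradient_eq_zero_of_notMem_tsupport

theorem memLp (h : IsTest Ω φ) : MemLp φ 2 (volume.restrict Ω) :=
  h.1.continuous.memLp_of_hasCompactSupport h.2.1 |>.restrict Ω

theorem memLp_gradient (h : IsTest Ω φ) : MemLp (gradient φ) 2 (volume.restrict Ω) :=
  (contDiff_gradient h.1).continuous.memLp_of_hasCompactSupport
    h.hasCompactSupport_gradient |>.restrict Ω

theorem zero : IsTest Ω (0 : E d → ℝ) :=
  ⟨contDiff_const, HasCompactSupport.zero, by simp [tsupport]⟩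

theorem add (h : IsTest Ω φ) (k : IsTest Ω ψ) : IsTest Ω (φ + ψ) :=
  ⟨h.1.add k.1, h.2.1.add k.2.1, (tsupport_add φ ψ).trans (Set.union_subset h.2.2 k.2.2)⟩

theorem mul_left (h : IsTest Ω φ) {F : E d → ℝ} (hF : ContDiff ℝ ∞ F) :
    IsTest Ω (fun x => F x * φ x) :=
  ⟨hF.mul h.1, h.2.1.mul_left, (tsupport_mul_subset_right).trans h.2.2⟩

end IsTest

/-- The graph of the gradient on test functions, as a subspace of `L²(Ω) × L²(Ω)ᵈ`. -/
noncomputable def testGraph (Ω : Set (E d)) : Submodule ℝ (WithLp 2 (L2 Ω × L2Vec Ω)) where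
  carrier := {z | ∃ φ : E d → ℝ, IsTest Ω φ ∧ z.fst =ᵐ[volume.restrict Ω] φ ∧
    z.snd =ᵐ[volume.restrict Ω] gradient φ}
  zero_mem' := ⟨0, IsTest.zero, Lp.coeFn_zero _ _ _, by
    refine (Lp.coeFn_zero _ _ _).trans (Filter.Eventually.of_forall fun x => ?_)
    exact (gradient_const x (0 : ℝ)).symm⟩
  add_mem' := by
    rintro z w ⟨φ, hφ, hz, hz'⟩ ⟨ψ, hψ, hw, hw'⟩
    refine ⟨φ + ψ, hφ.add hψ, (Lp.coeFn_add _ _).trans (hz.add hw),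
      (Lp.coeFn_add _ _).trans ((hz'.add hw').trans (Filter.Eventually.of_forall fun x => ?_))⟩
    refine ext_inner_left ℝ fun e => ?_
    rw [inner_gradient, fderiv_add (hφ.1.differentiable (by simp) x)
      (hψ.1.differentiable (by simp) x)]
    simp [inner_add_right]
  smul_mem' := by
    rintro c z ⟨φ, hφ, hz, hz'⟩
    refine ⟨fun x => c * φ x, hφ.mul_left contDiff_const,
      (Lp.coeFn_smul _ _).trans (hz.const_smul c),
      (Lp.coeFn_smul _ _).trans ((hz'.const_smul c).trans
        (Filter.Eventually.of_forall fun x => ?_))⟩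
    refine ext_inner_left ℝ fun e => ?_
    rw [inner_gradient, fderiv_const_mul (hφ.1.differentiable (by simp) x)]
    simp [inner_smul_right]

theorem IsTest.toLp_mem_testGraph {φ : E d → ℝ} (h : IsTest Ω φ) :
    WithLp.toLp 2 (h.memLp.toLp φ, h.memLp_gradient.toLp (gradient φ)) ∈ testGraph Ω :=
  ⟨φ, h, h.memLp.coeFn_toLp, h.memLp_gradient.coeFn_toLp⟩

/-! ### `H(div; Ω)` and `H¹₀(Ω)` as mutual annihilators -/

theorem inner_congr_left {F : Type*} [NormedAddCommGroup F] [InnerProductSpace ℝ F]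
    {u w : Lp F 2 (volume.restrict Ω)} {φ : E d → F} (h : u =ᵐ[volume.restrict Ω] φ) :
    inner ℝ u w = ∫ x in Ω, inner ℝ (φ x) (w x) := by
  rw [L2.inner_def]
  exact integral_congr_ae (h.mono fun x hx => by simp only [hx])

/-- `H(div; Ω)` is the annihilator of the test graph. The components are exchanged because the
divergence is minus the adjoint of the gradient. -/
theorem hasWeakDiv_iff {ξ : L2Vec Ω} {w : L2 Ω} :
    HasWeakDiv Ω ξ w ↔ WithLp.toLp 2 (w, ξ) ∈ (testGraph Ω)ᗮ := by
  have key {z : WithLp 2 (L2 Ω × L2Vec Ω)} {φ : E d → ℝ}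
      (h : z.fst =ᵐ[volume.restrict Ω] φ) (h' : z.snd =ᵐ[volume.restrict Ω] gradient φ) :
      inner ℝ z (WithLp.toLp 2 (w, ξ)) =
        (∫ x in Ω, w x * φ x) + ∫ x in Ω, inner ℝ (ξ x) (gradient φ x) := by
    rw [WithLp.prod_inner_apply]
    change inner ℝ z.fst w + inner ℝ z.snd ξ = _
    rw [inner_congr_left h, inner_congr_left h']
    simp [mul_comm]
  rw [Submodule.mem_orthogonal]
  constructor
  · rintro h z ⟨φ, hφ, hz, hz'⟩
    rw [key hz hz', h φ hφ, add_neg_cancel]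
  · intro h φ hφ
    have := h _ hφ.toLp_mem_testGraph
    rw [key (z := WithLp.toLp 2 (hφ.memLp.toLp φ, hφ.memLp_gradient.toLp (gradient φ)))
      hφ.memLp.coeFn_toLp hφ.memLp_gradient.coeFn_toLp] at this
    linarith

/-- Both integrands are supported in `Ω`, so this is integration by parts on the whole space. -/
theorem IsTest.integral_mul_fderiv {φ ψ : E d → ℝ} (hφ : IsTest Ω φ) (hψ : IsTest Ω ψ) (e : E d) :
    ∫ x in Ω, φ x * fderiv ℝ ψ x e = - ∫ x in Ω, fderiv ℝ φ x e * ψ x := by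
  have hφ' : Continuous fun x => fderiv ℝ φ x e :=
    (hφ.1.continuous_fderiv (by simp)).clm_apply continuous_const
  have hψ' : Continuous fun x => fderiv ℝ ψ x e :=
    (hψ.1.continuous_fderiv (by simp)).clm_apply continuous_const
  rw [setIntegral_eq_integral_of_forall_compl_eq_zero,
    setIntegral_eq_integral_of_forall_compl_eq_zero]
  · apply integral_mul_fderiv_eq_neg_fderiv_mul_of_integrable
    · exact (hφ'.mul hψ.1.continuous).integrable_of_hasCompactSupport hψ.2.1.mul_left
    · exact (hφ.1.continuous.mul hψ').integrable_of_hasCompactSupport hφ.2.1.mul_right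
    · exact (hφ.1.continuous.mul hψ.1.continuous).integrable_of_hasCompactSupport hφ.2.1.mul_right
    · exact fun x _ => hφ.1.differentiable (by simp) x
    · exact fun x _ => hψ.1.differentiable (by simp) x
  · intro x hx
    rw [image_eq_zero_of_notMem_tsupport fun h => hx (hψ.2.2 h), mul_zero]
  · intro x hx
    rw [image_eq_zero_of_notMem_tsupport fun h => hx (hφ.2.2 h), zero_mul]

theorem integrable_smul_of_memLp {F : Type*} [NormedAddCommGroup F] [NormedSpace ℝ F]
    {μ : Measure (E d)} {f : E d → ℝ} {g : E d → F} (hf : MemLp f 2 μ) (hg : MemLp g 2 μ) :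
    Integrable (fun x => f x • g x) μ :=
  memLp_one_iff_integrable.1 (hg.smul hf)

/-- The weak gradient is tested by pairing with the smooth fields `φ e` only, whose weak divergence
is `∂ₑφ`. -/
theorem hasWeakGrad_of_forall {u : L2 Ω} {g : L2Vec Ω}
    (h : ∀ (ξ : L2Vec Ω) (w : L2 Ω), HasWeakDiv Ω ξ w → inner ℝ u w + inner ℝ g ξ = 0) :
    HasWeakGrad Ω u g := by
  intro φ hφ
  refine ext_inner_left ℝ fun e => ?_
  rw [inner_neg_right, ← integral_inner (integrable_smul_of_memLp (Lp.memLp u) hφ.memLp_gradient),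
    ← integral_inner (integrable_smul_of_memLp hφ.memLp (Lp.memLp g))]
  have hξ : MemLp (fun x => φ x • e) 2 (volume.restrict Ω) :=
    (hφ.1.continuous.smul continuous_const).memLp_of_hasCompactSupport
      hφ.2.1.smul_right |>.restrict Ω
  have hw : MemLp (fun x => fderiv ℝ φ x e) 2 (volume.restrict Ω) :=
    ((hφ.1.continuous_fderiv (by simp)).clm_apply continuous_const).memLp_of_hasCompactSupport
      (hφ.2.1.fderiv_apply ℝ e) |>.restrict Ω
  have hdiv : HasWeakDiv Ω (hξ.toLp _) (hw.toLp _) := by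
    intro ψ hψ
    calc
      _ = ∫ x in Ω, φ x * fderiv ℝ ψ x e := integral_congr_ae <| hξ.coeFn_toLp.mono fun x hx => by
            simp only [hx, real_inner_smul_left, inner_gradient]
      _ = - ∫ x in Ω, fderiv ℝ φ x e * ψ x := hφ.integral_mul_fderiv hψ e
      _ = _ := by
        congr 1
        exact integral_congr_ae <| hw.coeFn_toLp.mono fun x hx => by simp only [hx]
  have := h _ _ hdiv
  rw [real_inner_comm, inner_congr_left hw.coeFn_toLp, real_inner_comm,
    inner_congr_left hξ.coeFn_toLp] at this
  simp only [real_inner_smul_right, real_inner_smul_left, inner_gradient] at this ⊢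
  rw [← eq_neg_iff_add_eq_zero] at this
  simpa [mul_comm] using this

/-- `H¹₀(Ω)` is the annihilator of `H(div; Ω)`: the closure of a subspace is its double orthogonal
complement. -/
theorem hasGradH10_iff {u : L2 Ω} {g : L2Vec Ω} :
    HasGradH10 Ω u g ↔
      ∀ (ξ : L2Vec Ω) (w : L2 Ω), HasWeakDiv Ω ξ w → inner ℝ u w + inner ℝ g ξ = 0 := by
  constructor
  · rintro ⟨-, h⟩ ξ w hdiv
    rw [hasWeakDiv_iff] at hdiv
    by_contra hne
    -- The pairing vanishes on test functions; approximate within `|S| / C`, where the bound `C` on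
    -- the functional is enlarged by one so that it is positive and the inequality strict.
    set S := inner ℝ u w + inner ℝ g ξ
    set C := ‖w‖ + ‖ξ‖ + 1
    have hC : 0 < C := by positivity
    have hε : 0 < |S| / C := div_pos (abs_pos.2 hne) hC
    obtain ⟨φ, hφ, hu, hg⟩ := h _ (ENNReal.ofReal_pos.2 hε)
    have horth := Submodule.mem_orthogonal _ _ |>.1 hdiv _ hφ.toLp_mem_testGraph
    rw [WithLp.prod_inner_apply] at horth
    set a := hφ.memLp.toLp φ
    set b := hφ.memLp_gradient.toLp (gradient φ)
    have ha : ‖u - a‖ < |S| / C := by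
      rw [← dist_eq_norm, Lp.dist_def]
      refine ENNReal.toReal_lt_of_lt_ofReal (lt_of_eq_of_lt (eLpNorm_congr_ae ?_) hu)
      exact hφ.memLp.coeFn_toLp.mono fun x hx => by simp [a, hx]
    have hb : ‖g - b‖ < |S| / C := by
      rw [← dist_eq_norm, Lp.dist_def]
      refine ENNReal.toReal_lt_of_lt_ofReal (lt_of_eq_of_lt (eLpNorm_congr_ae ?_) hg)
      exact hφ.memLp_gradient.coeFn_toLp.mono fun x hx => by simp [b, hx]
    have hS : S = inner ℝ (u - a) w + inner ℝ (g - b) ξ := by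
      rw [inner_sub_left, inner_sub_left]
      simp only [S] at horth ⊢
      linarith
    have : |S| < |S| := calc
      |S| ≤ |S| / C * ‖w‖ + |S| / C * ‖ξ‖ := by
        conv_lhs => rw [hS]
        refine (abs_add_le _ _).trans (add_le_add ?_ ?_)
        · exact (abs_real_inner_le_norm _ _).trans (by gcongr)
        · exact (abs_real_inner_le_norm _ _).trans (by gcongr)
      _ < |S| / C * C := by
        simp only [C, mul_add, mul_one]
        exact lt_add_of_pos_right _ hε
      _ = |S| := div_mul_cancel₀ _ hC.ne'
    exact this.false
  · intro h
    refine ⟨hasWeakGrad_of_forall h, fun ε hε => ?_⟩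
    have hmem : WithLp.toLp 2 (u, g) ∈ (testGraph Ω).topologicalClosure := by
      rw [← Submodule.orthogonal_orthogonal_eq_closure, Submodule.mem_orthogonal]
      intro z hz
      have := h z.snd z.fst (hasWeakDiv_iff.2 hz)
      rw [real_inner_comm]
      exact this
    obtain ⟨z, ⟨φ, hφ, hz, hz'⟩, hlt⟩ := EMetric.mem_closure_iff.1 hmem ε hε
    refine ⟨φ, hφ, ?_, ?_⟩
    · have := (WithLp.edist_fst_le (p := 2) _ _).trans_lt hlt
      rw [Lp.edist_def] at this
      refine lt_of_eq_of_lt (eLpNorm_congr_ae ?_) this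
      exact hz.mono fun x hx => by simp [← hx]
    · have := (WithLp.edist_snd_le (p := 2) _ _).trans_lt hlt
      rw [Lp.edist_def] at this
      refine lt_of_eq_of_lt (eLpNorm_congr_ae ?_) this
      exact hz'.mono fun x hx => by simp [← hx]

theorem HasWeakDiv.inner_add_inner {u : L2 Ω} {g ξ : L2Vec Ω} {w : L2 Ω}
    (h : HasWeakDiv Ω ξ w) (hu : HasGradH10 Ω u g) : inner ℝ u w + inner ℝ g ξ = 0 :=
  hasGradH10_iff.1 hu ξ w h

theorem HasGradH10.smul {u : L2 Ω} {g : L2Vec Ω} (hu : HasGradH10 Ω u g) (c : ℝ) :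
    HasGradH10 Ω (c • u) (c • g) :=
  hasGradH10_iff.2 fun ξ w h => by
    rw [real_inner_smul_left, real_inner_smul_left, ← mul_add, h.inner_add_inner hu, mul_zero]

theorem HasGradH10.add {u v : L2 Ω} {g k : L2Vec Ω} (hu : HasGradH10 Ω u g)
    (hv : HasGradH10 Ω v k) : HasGradH10 Ω (u + v) (g + k) :=
  hasGradH10_iff.2 fun ξ w h => by
    rw [inner_add_left, inner_add_left]
    linear_combination h.inner_add_inner hu + h.inner_add_inner hv

theorem IsTest.hasGradH10 {φ : E d → ℝ} (h : IsTest Ω φ) :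
    HasGradH10 Ω (h.memLp.toLp φ) (h.memLp_gradient.toLp (gradient φ)) :=
  hasGradH10_iff.2 fun _ _ hdiv =>
    Submodule.mem_orthogonal _ _ |>.1 (hasWeakDiv_iff.1 hdiv) _ h.toLp_mem_testGraph

/-- A field lies in `H(div; Ω)` if integration by parts holds against all of `H¹₀(Ω)`, since
`H¹₀(Ω)` contains the test functions. -/
theorem hasWeakDiv_of_forall {ξ : L2Vec Ω} {w : L2 Ω}
    (h : ∀ (v : L2 Ω) (gv : L2Vec Ω), HasGradH10 Ω v gv → inner ℝ v w + inner ℝ gv ξ = 0) :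
    HasWeakDiv Ω ξ w := by
  rw [hasWeakDiv_iff, Submodule.mem_orthogonal]
  rintro z ⟨φ, hφ, hz, hz'⟩
  refine h z.fst z.snd ?_
  have h1 : z.fst = hφ.memLp.toLp φ := Lp.ext (hz.trans hφ.memLp.coeFn_toLp.symm)
  have h2 : z.snd = hφ.memLp_gradient.toLp (gradient φ) :=
    Lp.ext (hz'.trans hφ.memLp_gradient.coeFn_toLp.symm)
  rw [h1, h2]
  exact hφ.hasGradH10

/-! ### Injectivity of the gradient on `H¹₀(Ω)` -/

/-- The field `p arctan(x₁) e₁` is square integrable with divergence `p / (1 + x₁²)`, because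
`∇p = 0`. Pairing it with `(p, 0)` gives `∫ p² / (1 + x₁²) = 0`. The weight
`arctan` is chosen because it is bounded and smooth with a bounded positive derivative. -/
theorem HasGradH10.eq_zero_of_grad_eq_zero (hd : 0 < d) {p : L2 Ω} (hp : HasGradH10 Ω p 0) :
    p = 0 := by
  let i : Fin d := ⟨0, hd⟩
  let e : E d := EuclideanSpace.single i 1
  let F : E d → ℝ := fun x => Real.arctan (x i)
  let F' : E d → ℝ := fun x => 1 / (1 + (x i) ^ 2)
  have hi : ContDiff ℝ ∞ fun x : E d => x i := by fun_prop
  have hF : ContDiff ℝ ∞ F := Real.contDiff_arctan.comp hi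
  have hF'pos (x : E d) : 0 < F' x := by positivity
  have hF'c : Continuous F' := by
    refine continuous_const.div (by fun_prop) fun x => ?_
    positivity
  have hFF' (x : E d) : fderiv ℝ F x e = F' x := by
    have h1 : HasFDerivAt (fun x : E d => x i) (EuclideanSpace.proj i : E d →L[ℝ] ℝ) x :=
      (EuclideanSpace.proj i : E d →L[ℝ] ℝ).hasFDerivAt
    rw [(h1.arctan).fderiv]
    simp [F', e]
  have hξ : MemLp (fun x => (F x * p x) • e) 2 (volume.restrict Ω) := by
    refine (Lp.memLp p).of_le_mul (c := Real.pi / 2)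
      ((hF.continuous.aestronglyMeasurable.mul (Lp.aestronglyMeasurable p)).smul
        aestronglyMeasurable_const) (Filter.Eventually.of_forall fun x => ?_)
    have : |F x| ≤ Real.pi / 2 :=
      abs_le.2 ⟨(Real.neg_pi_div_two_lt_arctan _).le, (Real.arctan_lt_pi_div_two _).le⟩
    rw [norm_smul, norm_mul]
    simp only [e, PiLp.norm_single, norm_one, mul_one]
    gcongr
    exact this
  have hw : MemLp (fun x => F' x * p x) 2 (volume.restrict Ω) := by
    refine (Lp.memLp p).of_le_mul (c := 1)
      (hF'c.aestronglyMeasurable.mul (Lp.aestronglyMeasurable p))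
      (Filter.Eventually.of_forall fun x => ?_)
    rw [norm_mul, Real.norm_of_nonneg (hF'pos x).le]
    gcongr
    exact div_le_one_of_le₀ (by nlinarith [sq_nonneg (x i)]) (by positivity)
  have hdiv : HasWeakDiv Ω (hξ.toLp _) (hw.toLp _) := by
    intro φ hφ
    -- Test `∇p = 0` with `F φ`, where `∂ₑ(F φ) = F ∂ₑφ + F' φ`.
    have hFφ := hφ.mul_left hF
    have h0 : ∫ x in Ω, p x • gradient (fun x => F x * φ x) x = 0 := by
      rw [hp.1 _ hFφ, neg_eq_zero]
      refine integral_eq_zero_of_ae ((Lp.coeFn_zero (E d) 2 (volume.restrict Ω)).mono fun x hx => ?_)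
      exact (congrArg _ hx).trans (smul_zero _)
    have h1 := congrArg (inner ℝ e) h0
    rw [← integral_inner (integrable_smul_of_memLp (Lp.memLp p) hFφ.memLp_gradient),
      inner_zero_right] at h1
    have h2 : ∀ x, inner ℝ e (p x • gradient (fun x => F x * φ x) x) =
        inner ℝ ((F x * p x) • e) (gradient φ x) + F' x * p x * φ x := fun x => by
      rw [real_inner_smul_right, real_inner_smul_left, inner_gradient, inner_gradient,
        fderiv_fun_mul (hF.differentiable (by simp) x) (hφ.1.differentiable (by simp) x)]
      simp only [_root_.add_apply, _root_.smul_apply, smul_eq_mul, hFF']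
      ring
    simp only [h2] at h1
    have i1 : Integrable (fun x => inner ℝ ((F x * p x) • e) (gradient φ x))
        (volume.restrict Ω) := by
      have := L2.integrable_inner (𝕜 := ℝ) (hξ.toLp _) (hφ.memLp_gradient.toLp _)
      refine this.congr ?_
      filter_upwards [hξ.coeFn_toLp, hφ.memLp_gradient.coeFn_toLp] with x hx hx'
      rw [hx, hx']
    have i2 : Integrable (fun x => F' x * p x * φ x) (volume.restrict Ω) :=
      integrable_smul_of_memLp hw hφ.memLp
    rw [integral_add i1 i2, ← eq_neg_iff_add_eq_zero] at h1
    calc _ = _ := integral_congr_ae <| hξ.coeFn_toLp.mono fun x hx => by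
            simp only [hx]
      _ = _ := h1
      _ = _ := by
        congr 1
        exact integral_congr_ae <| hw.coeFn_toLp.mono fun x hx => by simp only [hx]
  have h := hdiv.inner_add_inner hp
  rw [inner_zero_left, add_zero, real_inner_comm, inner_congr_left hw.coeFn_toLp] at h
  -- A nonnegative integrand with zero integral vanishes, and `F'` has no zeros.
  have hint : Integrable (fun x => F' x * p x * p x) (volume.restrict Ω) :=
    integrable_smul_of_memLp hw (Lp.memLp p)
  have h' : ∫ x in Ω, F' x * p x * p x = 0 := by
    rw [← h]
    exact integral_congr_ae (Filter.Eventually.of_forall fun x => by simp [mul_comm])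
  rw [integral_eq_zero_iff_of_nonneg (fun x => by
    rw [mul_assoc]; exact mul_nonneg (hF'pos x).le (mul_self_nonneg _)) hint] at h'
  refine (Lp.eq_zero_iff_ae_eq_zero).2 (h'.mono fun x hx => ?_)
  simpa [mul_assoc, (hF'pos x).ne'] using hx

/-! ### The correspondence of the eigenvalue parameters -/

theorem toLaplace_pos {mu : ℝ} (hmu : 0 < mu) : 0 < toLaplace mu := by
  unfold toLaplace
  positivity

/-- `toLaplace μ` is the positive root of `x² = μ x + μ`. -/
theorem toLaplace_sq {mu : ℝ} (hmu : 0 < mu) :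
    toLaplace mu ^ 2 = mu * (toLaplace mu + 1) := by
  have := Real.sq_sqrt (show 0 ≤ mu ^ 2 + 4 * mu by positivity)
  unfold toLaplace
  linear_combination this / 4

theorem toLaplace_eq_of_sq {mu lam : ℝ} (hmu : 0 < mu) (hlam : 0 < lam)
    (h : lam ^ 2 = mu * (lam + 1)) : toLaplace mu = lam := by
  have hle : 0 ≤ 2 * lam - mu := by
    by_contra! hlt
    nlinarith
  have hs : mu ^ 2 + 4 * mu = (2 * lam - mu) ^ 2 := by linear_combination -4 * h
  rw [toLaplace, hs, Real.sqrt_sq hle]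
  ring

theorem toLaplace_injOn : Set.InjOn toLaplace (Set.Ioi 0) := by
  intro mu hmu nu hnu h
  have h1 := toLaplace_sq hmu
  have h2 := toLaplace_sq hnu
  have hpos := toLaplace_pos hnu
  rw [h, h2] at h1
  exact (mul_right_cancel₀ (by positivity) h1).symm

/-! ### Solutions of the two eigenproblems -/

theorem IsLaplaceEigenvalue.pos (hd : 0 < d) {lam : ℝ} (h : IsLaplaceEigenvalue Ω lam) :
    0 < lam := by
  obtain ⟨u, hu, g, hg, heq⟩ := h
  have hug := heq u g hg
  have hupos : 0 < inner ℝ u u := real_inner_self_pos.2 hu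
  have hgpos : 0 < inner ℝ g g := by
    refine real_inner_self_pos.2 fun h0 => hu ?_
    subst h0
    exact hg.eq_zero_of_grad_eq_zero hd
  rw [hug] at hgpos
  exact pos_of_mul_pos_left hgpos hupos.le

namespace IsLLStarSolution

variable {mu : ℝ} {p : L2 Ω} {gp χ : L2Vec Ω} {dχ : L2 Ω}

/-- The first equation says that `(-div χ, ∇p - χ)` annihilates the graph of the divergence. -/
theorem hasGradH10_neg_div (h : IsLLStarSolution Ω mu p gp χ dχ) :
    HasGradH10 Ω (-dχ) (gp - χ) :=
  hasGradH10_iff.2 fun ξ w hdiv => by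
    rw [inner_neg_left, inner_sub_left]
    linear_combination -h.first_eq ξ w hdiv

/-- With `u = -div χ`, the second equation reads `-Δu = μ p`. -/
theorem inner_grad_neg_div (h : IsLLStarSolution Ω mu p gp χ dχ) {q : L2 Ω} {gq : L2Vec Ω}
    (hq : HasGradH10 Ω q gq) : inner ℝ (gp - χ) gq = mu * inner ℝ p q := by
  rw [inner_sub_left]
  linear_combination h.second_eq q gq hq

/-- With `u = -div χ`, the function `p` satisfies `-Δp = μ p + u`. -/
theorem inner_grad (h : IsLLStarSolution Ω mu p gp χ dχ) {q : L2 Ω} {gq : L2Vec Ω}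
    (hq : HasGradH10 Ω q gq) : inner ℝ gp gq = mu * inner ℝ p q + inner ℝ (-dχ) q := by
  have h1 := h.div_chi.inner_add_inner hq
  rw [real_inner_comm, real_inner_comm χ gq] at h1
  rw [inner_neg_left]
  linear_combination h.second_eq q gq hq + h1

/-- Testing both equations with `p` and `u = -div χ` gives `μ ‖p‖² = ‖∇u‖² + ‖u‖²`. -/
theorem pos (hd : 0 < d) (h : IsLLStarSolution Ω mu p gp χ dχ) : 0 < mu := by
  have hu := h.hasGradH10_neg_div
  have hp : 0 < inner ℝ p p := real_inner_self_pos.2 h.p_ne_zero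
  have h1 := h.inner_grad_neg_div h.grad_p
  have h2 := h.inner_grad hu
  have h3 := h.inner_grad_neg_div hu
  rw [real_inner_comm, h2, ← h3] at h1
  have hg0 : 0 ≤ inner ℝ (gp - χ) (gp - χ) := real_inner_self_nonneg
  have hu0 : 0 ≤ inner ℝ (-dχ) (-dχ) := real_inner_self_nonneg
  refine pos_of_mul_pos_left (lt_of_le_of_ne (h1 ▸ add_nonneg hg0 hu0) fun h0 => ?_) hp.le
  -- If `μ = 0` then `u = 0`, hence `-Δp = 0`.
  have hd0 : -dχ = 0 := inner_self_eq_zero (𝕜 := ℝ).1 (by linarith)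
  have h4 := h.inner_grad h.grad_p
  rw [← h0, hd0, inner_zero_left, add_zero, inner_self_eq_zero] at h4
  have hgp := h.grad_p
  rw [h4] at hgp
  exact h.p_ne_zero (hgp.eq_zero_of_grad_eq_zero hd)

/-- If `λ' = μ - λ` is the negative root of `x² = μ x + μ`, then `w = u + λ' p` satisfies
`-Δw = λ' w`, which forces `w = 0`. -/
theorem neg_div_eq (hd : 0 < d) (h : IsLLStarSolution Ω mu p gp χ dχ) :
    -dχ = (toLaplace mu - mu) • p := by
  have hmu := h.pos hd
  have hlam := toLaplace_pos hmu
  have hsq := toLaplace_sq hmu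
  set lam := toLaplace mu
  set c := mu - lam with hc
  have hcneg : c < 0 := by nlinarith
  have hw := h.hasGradH10_neg_div.add (h.grad_p.smul c)
  have h1 := h.inner_grad_neg_div hw
  have h2 := h.inner_grad hw
  set w := -dχ + c • p with hwdef
  set gw := (gp - χ) + c • gp with hgwdef
  have heq : inner ℝ gw gw = c * inner ℝ w w := by
    conv_lhs => rw [hgwdef, inner_add_left, real_inner_smul_left, h1, h2]
    conv_rhs => rw [hwdef, inner_add_left, real_inner_smul_left]
    linear_combination (-inner ℝ p w) * hsq
  have hg0 : 0 ≤ inner ℝ gw gw := real_inner_self_nonneg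
  have hw0 : w = 0 := by
    by_contra hne
    exact absurd (heq ▸ hg0) (mul_neg_of_neg_of_pos hcneg (real_inner_self_pos.2 hne)).not_ge
  rw [← sub_eq_zero, ← hw0, hwdef, hc]
  module

theorem eq_smul_neg_div (hd : 0 < d) (h : IsLLStarSolution Ω mu p gp χ dχ) :
    p = (toLaplace mu / mu) • (-dχ) := by
  have hmu := h.pos hd
  have : toLaplace mu / mu * (toLaplace mu - mu) = 1 := by
    field_simp
    linear_combination toLaplace_sq hmu
  rw [h.neg_div_eq hd, smul_smul, this, one_smul]

theorem isLaplaceEigenfunction (hd : 0 < d) (h : IsLLStarSolution Ω mu p gp χ dχ) :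
    IsLaplaceEigenfunction Ω (toLaplace mu) (-dχ) := by
  refine ⟨fun h0 => h.p_ne_zero ?_, gp - χ, h.hasGradH10_neg_div, fun v gv hv => ?_⟩
  · rw [h.eq_smul_neg_div hd, h0, smul_zero]
  · have hmu := h.pos hd
    rw [h.inner_grad_neg_div hv, h.eq_smul_neg_div hd, real_inner_smul_left]
    field_simp

end IsLLStarSolution

/-- The converse construction: `p = (λ / μ) u` and `χ = ∇p - ∇u`. -/
theorem IsLaplaceEigenfunction.exists_isLLStarSolution {mu lam : ℝ} (hmu : 0 < mu)
    (hlam : 0 < lam) (hsq : lam ^ 2 = mu * (lam + 1)) {u : L2 Ω}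
    (h : IsLaplaceEigenfunction Ω lam u) :
    ∃ gp χ : L2Vec Ω, IsLLStarSolution Ω mu ((lam / mu) • u) gp χ (-u) := by
  obtain ⟨hu, g, hg, heq⟩ := h
  refine ⟨(lam / mu) • g, (lam / mu - 1) • g, smul_ne_zero (div_pos hlam hmu).ne' hu,
    hg.smul _, hasWeakDiv_of_forall fun v gv hv => ?_, fun ξ dξ hdiv => ?_, fun q gq hq => ?_⟩
  · rw [inner_neg_right, real_inner_smul_right, real_inner_comm g gv, heq v gv hv,
      real_inner_comm u v]
    field_simp
    linear_combination inner ℝ u v * hsq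
  · rw [real_inner_smul_left, real_inner_smul_left, inner_neg_left]
    linear_combination -hdiv.inner_add_inner hg
  · rw [real_inner_smul_left, real_inner_smul_left, real_inner_smul_left, heq q gq hq]
    field_simp
    ring

end
end LLStar

theorem mainTheorem8 (d : ℕ) (hd : 0 < d) (Ω : Set (LLStar.E d)) (hΩ : IsOpen Ω) :
    -- one-to-one correspondence of the eigenvalues
    (∀ mu : ℝ, LLStar.IsLLStarEigenvalue Ω mu → 0 < mu) ∧
    Set.BijOn LLStar.toLaplace
      {mu : ℝ | LLStar.IsLLStarEigenvalue Ω mu} {lam : ℝ | LLStar.IsLaplaceEigenvalue Ω lam} ∧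
    -- `u = -div χ` is a Laplace eigenfunction and `∇u = ∇p - χ`
    (∀ (mu : ℝ) (p : LLStar.L2 Ω) (gp χ : LLStar.L2Vec Ω) (dχ : LLStar.L2 Ω),
      LLStar.IsLLStarSolution Ω mu p gp χ dχ →
        LLStar.IsLaplaceEigenfunction Ω (LLStar.toLaplace mu) (-dχ) ∧
        LLStar.HasGradH10 Ω (-dχ) (gp - χ)) ∧
    -- every Laplace eigenfunction arises in this way, from exactly one `p`
    (∀ mu : ℝ, LLStar.IsLLStarEigenvalue Ω mu →
      ∀ u : LLStar.L2 Ω, LLStar.IsLaplaceEigenfunction Ω (LLStar.toLaplace mu) u →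
        ∃! p : LLStar.L2 Ω, ∃ (gp χ : LLStar.L2Vec Ω) (dχ : LLStar.L2 Ω),
          LLStar.IsLLStarSolution Ω mu p gp χ dχ ∧ u = -dχ) := by
  have hpos : ∀ mu : ℝ, LLStar.IsLLStarEigenvalue Ω mu → 0 < mu :=
    fun mu ⟨_, _, _, _, h⟩ => h.pos hd
  refine ⟨hpos, ⟨?_, LLStar.toLaplace_injOn.mono hpos, ?_⟩,
    fun mu p gp χ dχ h => ⟨h.isLaplaceEigenfunction hd, h.hasGradH10_neg_div⟩, ?_⟩
  · rintro mu ⟨p, gp, χ, dχ, h⟩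
    exact ⟨-dχ, h.isLaplaceEigenfunction hd⟩
  · intro lam hlam
    have hl : 0 < lam := LLStar.IsLaplaceEigenvalue.pos hd hlam
    have hmu : 0 < lam ^ 2 / (lam + 1) := by positivity
    have hsq : lam ^ 2 = lam ^ 2 / (lam + 1) * (lam + 1) := by field_simp
    obtain ⟨u, hu⟩ := hlam
    obtain ⟨gp, χ, h⟩ := hu.exists_isLLStarSolution hmu hl hsq
    exact ⟨_, ⟨_, gp, χ, _, h⟩, LLStar.toLaplace_eq_of_sq hmu hl hsq⟩
  · intro mu hev u hu
    have hmu := hpos mu hev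
    obtain ⟨gp, χ, h⟩ :=
      hu.exists_isLLStarSolution hmu (LLStar.toLaplace_pos hmu) (LLStar.toLaplace_sq hmu)
    refine ⟨_, ⟨gp, χ, -u, h, (neg_neg u).symm⟩, ?_⟩
    rintro p ⟨gp', χ', dχ, h', rfl⟩
    exact h'.eq_smul_neg_div hd
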